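/- Let $n\ge 1$ and $d\ge 0$ be integers, let $\Bbbk$ be a field whose characteristic is zero or strictly larger than $d$, and let $0\neq F\in\Bbbk[x_0,\dots,x_n]$ be a form of degree $d$. A \emph{local scheme} is a zero-dimensional closed subscheme $Z\subset\mathbb{P}^n_{\Bbbk}$ supported at a single $\Bbbk$-rational point, given by its saturated homogeneous ideal $I(Z)\subset\Bbbk[y_0,\dots,y_n]$; its length is the constant value of $\dim_{\Bbbk}(\Bbbk[y_0,\dots,y_n]/I(Z))_t$ for $t\gg 0$. It is \emph{apolar} to $F$ if every element of $I(Z)$ annihilates $F$, where $y_i$ acts as $\partial/\partial x_i$. The \emph{local cactus rank} of $F$ is the minimal length of a local scheme apolar to $F$, and a \emph{minimal local apolar scheme} of $F$ is a local scheme apolar to $F$ whose length is the local cactus rank of $F$. If the local cactus rank of $F$ is at most $d$, then $F$ has at most $d^n$ minimal local apolar schemes. -/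

import Mathlib

open MvPolynomial

/-- The differentiation action of `k[y_0, …, y_n]` on `k[x_0, …, x_n]`: it is bilinear, and
`y^β ∘ x^α = (α! / (α - β)!) x^(α - β)` if `β ≤ α`, and `0` otherwise
(`Nat.descFactorial a b = a! / (a - b)!` for `b ≤ a`). Both rings are written as
`MvPolynomial (Fin (n + 1)) k`. -/
noncomputable def diffAction {k : Type*} [Field k] {n : ℕ}
    (p F : MvPolynomial (Fin (n + 1)) k) : MvPolynomial (Fin (n + 1)) k :=
  ∑ β ∈ p.support, ∑ α ∈ F.support,
    if β ≤ α then
      monomial (α - β)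
        (coeff β p * coeff α F * ∏ i, (Nat.descFactorial (α i) (β i) : k))
    else 0

/-- The homogeneous ideal of the point of `ℙⁿ(k)` with homogeneous coordinates `v`: the ideal
generated by the forms that vanish at `v`. -/
noncomputable def pointIdeal {k : Type*} [Field k] {n : ℕ} (v : Fin (n + 1) → k) :
    Ideal (MvPolynomial (Fin (n + 1)) k) :=
  Ideal.span {p | ∃ t : ℕ, p.IsHomogeneous t ∧ eval v p = 0}

/-- A local (closed, zero-dimensional) subscheme of `ℙⁿ` over `k`, supported at a single
`k`-rational point. A closed subscheme is given by its saturated homogeneous ideal, and for such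
an ideal the support is the point `v` exactly if the radical is the homogeneous ideal of `v`. -/
@[ext]
structure LocalScheme (k : Type*) [Field k] (n : ℕ) where
  /-- The saturated homogeneous ideal of the scheme. -/
  ideal : Ideal (MvPolynomial (Fin (n + 1)) k)
  isHomogeneous : ∀ p ∈ ideal, ∀ t : ℕ, homogeneousComponent t p ∈ ideal
  isSaturated : ∀ p, (∀ i, X i * p ∈ ideal) → p ∈ ideal
  exists_support : ∃ v : Fin (n + 1) → k, v ≠ 0 ∧ ideal.radical = pointIdeal v

namespace LocalScheme

/-- The Hilbert function of `Z`: the `k`-dimension of the degree-`t` component of the homogeneous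
coordinate ring `k[y_0, …, y_n] / I(Z)`. -/
noncomputable def hilbertFunction {k : Type*} [Field k] {n : ℕ} (Z : LocalScheme k n)
    (t : ℕ) : ℕ :=
  Module.finrank k
    ((homogeneousSubmodule (Fin (n + 1)) k t).map (Ideal.Quotient.mkₐ k Z.ideal).toLinearMap)

/-- `Z` has length `r`: its Hilbert polynomial is the constant `r`, that is, the Hilbert function
takes the value `r` in all sufficiently large degrees. -/
def HasLength {k : Type*} [Field k] {n : ℕ} (Z : LocalScheme k n) (r : ℕ) : Prop :=
  ∀ᶠ t in Filter.atTop, Z.hilbertFunction t = r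

/-- `Z` is apolar to `F`: every element of the ideal of `Z` annihilates `F` by differentiation. -/
def IsApolarTo {k : Type*} [Field k] {n : ℕ} (Z : LocalScheme k n)
    (F : MvPolynomial (Fin (n + 1)) k) : Prop :=
  ∀ p ∈ Z.ideal, diffAction p F = 0

end LocalScheme

/-- The local cactus rank of `F`: the minimal length of a local scheme apolar to `F`. -/
noncomputable def localCactusRank {k : Type*} [Field k] {n : ℕ}
    (F : MvPolynomial (Fin (n + 1)) k) : ℕ :=
  sInf {r : ℕ | ∃ Z : LocalScheme k n, Z.IsApolarTo F ∧ Z.HasLength r}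

/-- `Z` is a minimal local apolar scheme of `F`: it is apolar to `F`, and its length is the local
cactus rank of `F`. -/
def LocalScheme.IsMinimalApolarTo {k : Type*} [Field k] {n : ℕ} (Z : LocalScheme k n)
    (F : MvPolynomial (Fin (n + 1)) k) : Prop :=
  Z.IsApolarTo F ∧ Z.HasLength (localCactusRank F)

/-! The bound is proved with `d` in place of `d ^ n`, by counting supports. Let `Z` be apolar to
`F`, of length `r ≤ d`, supported at `v`. By pigeonhole on the Hilbert function, every product of
`r` linear forms vanishing at `v` lies in `I(Z)` (`list_prod_mem`). So the degree-`d` forms in those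
linear forms kill `F`, which by adjointness says that `F` vanishes modulo the dual linear form `∑
v_i x_i`; hence that form divides `F` (`dualForm_dvd`). Different points give coprime linear forms,
so at most `d` supports occur. Each support carries at most one minimal scheme
(`IsMinimalApolarTo.eq_of_radical_eq`). If `Z` and `Y` share the support, `I(Z) + I(Y)` is already
saturated in degrees at least `r`, in particular from degree `d` on, and degree `d` decides
apolarity. Thus the intersection of `Z` and `Y` is apolar to `F`; minimality forces it to have the
same length, so it equals both. -/

/-! ### The differentiation action: Euler's identity and adjointness. -/

section Differentiation

variable {k : Type*} [Field k] {n : ℕ}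

/-- The action of the monomial `y^β` on `F`. -/
noncomputable def monomialDiff (β : Fin (n + 1) →₀ ℕ) (F : MvPolynomial (Fin (n + 1)) k) :
    MvPolynomial (Fin (n + 1)) k :=
  ∑ α ∈ F.support, if β ≤ α then
    monomial (α - β) (coeff α F * ∏ i, (Nat.descFactorial (α i) (β i) : k)) else 0

lemma diffAction_eq_sum (p F : MvPolynomial (Fin (n + 1)) k)
    {s : Finset (Fin (n + 1) →₀ ℕ)} (hs : p.support ⊆ s) :
    diffAction p F = ∑ β ∈ s, coeff β p • monomialDiff β F := by
  rw [← Finset.sum_subset hs fun β _ hβ => by rw [notMem_support_iff.mp hβ, zero_smul]]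
  unfold diffAction monomialDiff
  refine Finset.sum_congr rfl fun β _ => ?_
  rw [Finset.smul_sum]
  refine Finset.sum_congr rfl fun α _ => ?_
  split_ifs
  · rw [smul_monomial, smul_eq_mul, mul_assoc]
  · rw [smul_zero]

lemma diffAction_add (p q F : MvPolynomial (Fin (n + 1)) k) :
    diffAction (p + q) F = diffAction p F + diffAction q F := by
  classical
  rw [diffAction_eq_sum (p + q) F support_add,
    diffAction_eq_sum p F Finset.subset_union_left,
    diffAction_eq_sum q F Finset.subset_union_right, ← Finset.sum_add_distrib]
  exact Finset.sum_congr rfl fun β _ => by rw [coeff_add, add_smul]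

lemma diffAction_monomial (β : Fin (n + 1) →₀ ℕ) (c : k) (F : MvPolynomial (Fin (n + 1)) k) :
    diffAction (monomial β c) F = c • monomialDiff β F := by
  classical
  rw [diffAction_eq_sum _ F support_monomial_subset, Finset.sum_singleton, coeff_monomial,
    if_pos rfl]

lemma diffAction_smul (c : k) (p F : MvPolynomial (Fin (n + 1)) k) :
    diffAction (c • p) F = c • diffAction p F := by
  induction p using MvPolynomial.induction_on' with
  | monomial β a => rw [smul_monomial, diffAction_monomial, diffAction_monomial, smul_assoc]
  | add p q hp hq => rw [smul_add, diffAction_add, hp, hq, diffAction_add, smul_add]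

/-- `diffAction` as a linear map in the differential operator. -/
noncomputable def diffActionLinear (F : MvPolynomial (Fin (n + 1)) k) :
    MvPolynomial (Fin (n + 1)) k →ₗ[k] MvPolynomial (Fin (n + 1)) k where
  toFun p := diffAction p F
  map_add' p q := diffAction_add p q F
  map_smul' c p := diffAction_smul c p F

lemma diffActionLinear_apply (p F : MvPolynomial (Fin (n + 1)) k) :
    diffActionLinear F p = diffAction p F := rfl

/-- The falling factorial of `α i` gains the factor `α i - β i`, which is the exponent that `∂_i`
brings down. If `β ≤ α` but the larger exponent does not fit, that factor is zero. -/
lemma monomialDiff_single_add (i : Fin (n + 1)) (β : Fin (n + 1) →₀ ℕ)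
    (F : MvPolynomial (Fin (n + 1)) k) :
    monomialDiff (Finsupp.single i 1 + β) F = pderiv i (monomialDiff β F) := by
  classical
  unfold monomialDiff
  rw [map_sum]
  refine Finset.sum_congr rfl fun α _ => ?_
  by_cases hβ : β ≤ α
  · rw [if_pos hβ, pderiv_monomial]
    have hprod : (∏ m, (Nat.descFactorial (α m) ((Finsupp.single i 1 + β : Fin (n + 1) →₀ ℕ) m) : k)) =
        (∏ m, (Nat.descFactorial (α m) (β m) : k)) * ((α - β) i : ℕ) := by
      rw [← Finset.mul_prod_erase Finset.univ
          (fun m => (Nat.descFactorial (α m) ((Finsupp.single i 1 + β : Fin (n + 1) →₀ ℕ) m) : k)) (Finset.mem_univ i),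
        ← Finset.mul_prod_erase Finset.univ
          (fun m => (Nat.descFactorial (α m) (β m) : k)) (Finset.mem_univ i)]
      have h1 : ∀ m ∈ Finset.univ.erase i,
          (Nat.descFactorial (α m) ((Finsupp.single i 1 + β : Fin (n + 1) →₀ ℕ) m) : k) =
            Nat.descFactorial (α m) (β m) := by
        intro m hm
        rw [Finsupp.add_apply, Finsupp.single_eq_of_ne (Finset.ne_of_mem_erase hm), zero_add]
      rw [Finset.prod_congr rfl h1, Finsupp.add_apply, Finsupp.single_eq_same, add_comm 1,
        Nat.descFactorial_succ, Finsupp.tsub_apply]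
      push_cast
      ring
    by_cases hβ' : Finsupp.single i 1 + β ≤ α
    · rw [if_pos hβ', hprod, tsub_tsub, add_comm β, mul_assoc]
    · rw [if_neg hβ']
      have : (α - β) i = 0 := by
        by_contra h
        refine hβ' fun m => ?_
        have := hβ m
        rw [Finsupp.tsub_apply] at h
        rcases eq_or_ne m i with rfl | hm
        · rw [Finsupp.add_apply, Finsupp.single_eq_same]; omega
        · rw [Finsupp.add_apply, Finsupp.single_eq_of_ne hm]; omega
      rw [this, Nat.cast_zero, mul_zero, monomial_zero]
  · rw [if_neg hβ, if_neg fun h => hβ (le_trans le_add_self h), map_zero]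

lemma diffAction_one (F : MvPolynomial (Fin (n + 1)) k) : diffAction 1 F = F := by
  have : (1 : MvPolynomial (Fin (n + 1)) k) = monomial 0 1 := rfl
  rw [this, diffAction_monomial, one_smul, monomialDiff]
  conv_rhs => rw [← support_sum_monomial_coeff F]
  exact Finset.sum_congr rfl fun α _ => by simp

lemma diffAction_X_mul (i : Fin (n + 1)) (p F : MvPolynomial (Fin (n + 1)) k) :
    diffAction (X i * p) F = pderiv i (diffAction p F) := by
  induction p using MvPolynomial.induction_on' with
  | monomial β a =>
    rw [X, monomial_mul, one_mul, diffAction_monomial, diffAction_monomial,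
      monomialDiff_single_add, Derivation.map_smul]
  | add p q hp hq => rw [mul_add, diffAction_add, hp, hq, diffAction_add, map_add]

lemma diffAction_isHomogeneous {p F : MvPolynomial (Fin (n + 1)) k} {s d : ℕ}
    (hp : p.IsHomogeneous s) (hF : F.IsHomogeneous d) :
    (diffAction p F).IsHomogeneous (d - s) := by
  unfold diffAction
  refine IsHomogeneous.sum _ _ _ fun β hβ => IsHomogeneous.sum _ _ _ fun α hα => ?_
  split_ifs with h
  · refine isHomogeneous_monomial _ ?_
    have hs := hp.degree_eq_sum_deg_support hβ
    have hd := hF.degree_eq_sum_deg_support hα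
    have h2 : α - β + β = α := tsub_add_cancel_of_le h
    have := congrArg Finsupp.degree h2
    rw [map_add] at this
    rw [Finsupp.degree_apply β, Finsupp.degree_apply α] at this
    omega
  · exact isHomogeneous_zero ..

lemma natCast_ne_zero_of_ringChar {d m : ℕ} (hchar : ringChar k = 0 ∨ d < ringChar k)
    (hm : m ≠ 0) (hmd : m ≤ d) : (m : k) ≠ 0 := by
  rw [Ne, ringChar.spec]
  rintro ⟨c, rfl⟩
  rcases hchar with h | h
  · simp [h] at hm
  · have := Nat.le_of_dvd (Nat.pos_of_ne_zero hm) (dvd_mul_right _ _)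
    omega

/-- In characteristic zero or larger than `d`, whether a form of degree at most `d` annihilates a
form of degree `d` is detected by its multiples of degree `d`. -/
lemma diffAction_eq_zero_of_mul {d : ℕ} (hchar : ringChar k = 0 ∨ d < ringChar k)
    {F : MvPolynomial (Fin (n + 1)) k} (hF : F.IsHomogeneous d) (m : ℕ) :
    ∀ (s : ℕ) (p : MvPolynomial (Fin (n + 1)) k), p.IsHomogeneous s → s + m = d →
      (∀ q : MvPolynomial (Fin (n + 1)) k, q.IsHomogeneous m → diffAction (q * p) F = 0) →
      diffAction p F = 0 := by
  induction m with
  | zero =>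
    intro s p _ _ h
    simpa using h 1 (isHomogeneous_one _ _)
  | succ m ih =>
    intro s p hp hs h
    have hX : ∀ i, pderiv i (diffAction p F) = 0 := by
      intro i
      rw [← diffAction_X_mul]
      refine ih (1 + s) _ ((isHomogeneous_X k i).mul hp) (by omega) fun q hq => ?_
      rw [← mul_assoc]
      exact h _ (hq.mul (isHomogeneous_X k i))
    -- Euler's identity gives `(d - s) • (p ∘ F) = 0` with `0 < d - s ≤ d`. The characteristic
    -- matters only here.
    have hE := (diffAction_isHomogeneous hp hF).sum_X_mul_pderiv
    simp only [hX, mul_zero, Finset.sum_const_zero] at hE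
    have hne := natCast_ne_zero_of_ringChar (k := k) (m := d - s) hchar (by omega) (by omega)
    rw [← Nat.cast_smul_eq_nsmul k] at hE
    exact (smul_eq_zero.mp hE.symm).resolve_left hne

/-- Differentiation is adjoint to linear substitution: a linear substitution of the operators
corresponds to the transposed substitution of the variables. -/
lemma diffAction_aeval_transpose (T : Fin (n + 1) → Fin (n + 1) → k)
    (p F : MvPolynomial (Fin (n + 1)) k) :
    diffAction p (aeval (fun m => ∑ i, T i m • (X i : MvPolynomial (Fin (n + 1)) k)) F) =
      aeval (fun m => ∑ i, T i m • (X i : MvPolynomial (Fin (n + 1)) k))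
        (diffAction (aeval (fun i => ∑ m, T i m • (X m : MvPolynomial (Fin (n + 1)) k)) p) F) := by
  -- Chain rule for the substitution; the induction on `p` then peels off one derivative at a time.
  have hchain : ∀ (i : Fin (n + 1)) (G : MvPolynomial (Fin (n + 1)) k),
      pderiv i (aeval (fun m => ∑ i, T i m • (X i : MvPolynomial (Fin (n + 1)) k)) G) =
        ∑ m, T i m • aeval (fun m => ∑ i, T i m • (X i : MvPolynomial (Fin (n + 1)) k))
          (pderiv m G) := by
    intro i G
    classical
    induction G using MvPolynomial.induction_on with
    | C a => simp [algebraMap_eq]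
    | add p q hp hq => simp only [map_add, hp, hq, smul_add, Finset.sum_add_distrib]
    | mul_X p j hp =>
      have hj : pderiv i (∑ i', T i' j • (X i' : MvPolynomial (Fin (n + 1)) k)) = C (T i j) := by
        rw [map_sum, Finset.sum_eq_single i]
        · rw [Derivation.map_smul, pderiv_X_self, smul_eq_C_mul, mul_one]
        · intro b _ hb
          rw [Derivation.map_smul, pderiv_X_of_ne hb, smul_zero]
        · simp
      rw [map_mul, aeval_X, Derivation.leibniz, hp, hj]
      have hterm : ∀ m, T i m • (aeval fun m => ∑ i, T i m • (X i : MvPolynomial (Fin (n + 1)) k))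
            ((pderiv m) (p * X j)) =
          (if m = j then T i m • (aeval fun m => ∑ i, T i m •
            (X i : MvPolynomial (Fin (n + 1)) k)) p else 0) +
          (∑ i, T i j • (X i : MvPolynomial (Fin (n + 1)) k)) *
            (T i m • (aeval fun m => ∑ i, T i m • (X i : MvPolynomial (Fin (n + 1)) k))
              ((pderiv m) p)) := by
        intro m
        rw [Derivation.leibniz]
        split_ifs with h
        · subst h
          rw [pderiv_X_self, map_add, smul_add]
          simp only [smul_eq_mul, map_mul, aeval_X, mul_one, mul_smul_comm]
        · rw [pderiv_X_of_ne (Ne.symm h)]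
          simp only [smul_eq_mul, map_mul, aeval_X, mul_zero, zero_add, mul_smul_comm]
      rw [Finset.sum_congr rfl fun m _ => hterm m, Finset.sum_add_distrib,
        Finset.sum_ite_eq' Finset.univ j, if_pos (Finset.mem_univ _), ← Finset.mul_sum,
        smul_eq_mul, smul_eq_mul, smul_eq_C_mul, mul_comm (C _)]
  induction p using MvPolynomial.induction_on with
  | C a =>
    rw [aeval_C, algebraMap_eq, C_eq_smul_one, diffAction_smul, diffAction_smul, diffAction_one,
      diffAction_one, map_smul]
  | add p q hp hq => simp only [map_add, diffAction_add, hp, hq]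
  | mul_X p i hp =>
    rw [mul_comm, diffAction_X_mul, hp, hchain, map_mul, aeval_X, Finset.sum_mul,
      ← diffActionLinear_apply (∑ m, _), map_sum, map_sum]
    refine Finset.sum_congr rfl fun m _ => ?_
    rw [smul_mul_assoc, map_smul, map_smul, diffActionLinear_apply, diffAction_X_mul]

end Differentiation

/-! ### Homogeneous ideals and the ideal of a point. -/

section HomogeneousPolynomials

variable {k : Type*} [Field k] {n : ℕ}

lemma homogeneousComponent_add_mul {s : ℕ} {u : MvPolynomial (Fin (n + 1)) k}
    (hu : u.IsHomogeneous s) (p : MvPolynomial (Fin (n + 1)) k) (t : ℕ) :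
    homogeneousComponent (s + t) (u * p) = u * homogeneousComponent t p := by
  conv_lhs => rw [← sum_homogeneousComponent p, Finset.mul_sum, map_sum]
  have h : ∀ i, homogeneousComponent (s + t) (u * homogeneousComponent i p) =
      if i = t then u * homogeneousComponent i p else 0 := by
    intro i
    rw [homogeneousComponent_of_mem (hu.mul (homogeneousComponent_isHomogeneous i p))]
    simp only [add_right_inj, eq_comm]
  rw [Finset.sum_congr rfl fun i _ => h i, Finset.sum_ite_eq']
  split_ifs with ht
  · rfl
  · rw [homogeneousComponent_eq_zero t p (by simpa using ht), mul_zero]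

lemma mem_of_homogeneousComponent_mem {I : Ideal (MvPolynomial (Fin (n + 1)) k)}
    {p : MvPolynomial (Fin (n + 1)) k} (h : ∀ t, homogeneousComponent t p ∈ I) : p ∈ I := by
  rw [← sum_homogeneousComponent p]
  exact sum_mem fun t _ => h t

lemma homogeneousComponent_mem_sup {I J : Ideal (MvPolynomial (Fin (n + 1)) k)}
    (hI : ∀ p ∈ I, ∀ t : ℕ, homogeneousComponent t p ∈ I)
    (hJ : ∀ p ∈ J, ∀ t : ℕ, homogeneousComponent t p ∈ J) :
    ∀ p ∈ I ⊔ J, ∀ t : ℕ, homogeneousComponent t p ∈ I ⊔ J := by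
  intro p hp t
  obtain ⟨a, ha, b, hb, rfl⟩ := Submodule.mem_sup.mp hp
  rw [map_add]
  exact Submodule.add_mem_sup (hI a ha t) (hJ b hb t)

lemma mem_pointIdeal_of_isHomogeneous {v : Fin (n + 1) → k} {t : ℕ}
    {p : MvPolynomial (Fin (n + 1)) k} (hp : p.IsHomogeneous t) (h : eval v p = 0) :
    p ∈ pointIdeal v :=
  Ideal.subset_span ⟨t, hp, h⟩

lemma eval_eq_zero_of_mem_pointIdeal {v : Fin (n + 1) → k}
    {p : MvPolynomial (Fin (n + 1)) k} (h : p ∈ pointIdeal v) : eval v p = 0 := by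
  have : pointIdeal v ≤ RingHom.ker (eval v) := by
    refine Ideal.span_le.mpr ?_
    rintro q ⟨t, _, hq⟩
    exact hq
  exact this h

lemma eval_smul_of_isHomogeneous {t : ℕ} {p : MvPolynomial (Fin (n + 1)) k}
    (hp : p.IsHomogeneous t) (c : k) (v : Fin (n + 1) → k) :
    eval (c • v) p = c ^ t * eval v p := by
  rw [eval_eq, eval_eq, Finset.mul_sum]
  refine Finset.sum_congr rfl fun β hβ => ?_
  rw [hp.degree_eq_sum_deg_support hβ, ← Finset.prod_pow_eq_pow_sum, mul_left_comm,
    ← Finset.prod_mul_distrib]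
  congr 1
  exact Finset.prod_congr rfl fun i _ => by rw [Pi.smul_apply, smul_eq_mul, mul_pow]

lemma pointIdeal_smul {c : k} (hc : c ≠ 0) (v : Fin (n + 1) → k) :
    pointIdeal (c • v) = pointIdeal v := by
  unfold pointIdeal
  congr 1
  ext p
  refine exists_congr fun t => and_congr_right fun hp => ?_
  rw [eval_smul_of_isHomogeneous hp, mul_eq_zero, or_iff_right (pow_ne_zero t hc)]

/-- A polynomial is congruent to any of its substitutions modulo an ideal containing the
differences of the substituted variables. -/
lemma sub_aeval_mem {I : Ideal (MvPolynomial (Fin (n + 1)) k)}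
    {z : Fin (n + 1) → MvPolynomial (Fin (n + 1)) k} (hz : ∀ i, X i - z i ∈ I)
    (p : MvPolynomial (Fin (n + 1)) k) : p - aeval z p ∈ I := by
  rw [← Ideal.Quotient.eq, ← Ideal.Quotient.mkₐ_eq_mk k]
  have : (Ideal.Quotient.mkₐ k I) = (Ideal.Quotient.mkₐ k I).comp (aeval z) := by
    refine algHom_ext fun i => ?_
    rw [AlgHom.comp_apply, aeval_X, Ideal.Quotient.mkₐ_eq_mk, Ideal.Quotient.eq]
    exact hz i
  exact congrArg (fun f => f p) this

end HomogeneousPolynomials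

/-! ### Nonzerodivisors, Hilbert function and length of a local scheme. -/

namespace LocalScheme

variable {k : Type*} [Field k] {n : ℕ} (Z : LocalScheme k n)

/-- Induction on the total exponent: `X i * p` satisfies the hypothesis with `m i` lowered by one,
and saturation descends from all `X i * p` to `p`. -/
lemma mem_of_X_pow_mul_mem {p : MvPolynomial (Fin (n + 1)) k} (m : Fin (n + 1) → ℕ)
    (h : ∀ i, X i ^ m i * p ∈ Z.ideal) : p ∈ Z.ideal := by
  induction hs : ∑ i, m i using Nat.strong_induction_on generalizing m p with
  | _ s ih =>
    by_cases h0 : ∃ i, m i = 0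
    · obtain ⟨i, hi⟩ := h0
      simpa [hi] using h i
    · push Not at h0
      refine Z.isSaturated p fun i => ?_
      refine ih _ ?_ (Function.update m i (m i - 1)) (fun j => ?_) rfl
      · rw [← hs]
        refine Finset.sum_lt_sum (fun j _ => ?_) ⟨i, Finset.mem_univ i, ?_⟩
        · rcases eq_or_ne j i with rfl | hj
          · simp
          · simp [hj]
        · have := h0 i
          simp only [Function.update_self]
          omega
      · rcases eq_or_ne j i with rfl | hj
        · rw [Function.update_self, ← mul_assoc, ← pow_succ, Nat.sub_add_cancel
            (Nat.one_le_iff_ne_zero.mpr (h0 j))]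
          exact h j
        · rw [Function.update_of_ne hj, mul_left_comm]
          exact Z.ideal.mul_mem_left _ (h j)

variable {Z} in
-- A form not vanishing at the support is a nonzerodivisor modulo `I(Z)`: the form `u(v) X_i^s -
-- v_i^s u` vanishes at `v`, hence is nilpotent there. So a power of each `X_i` is a multiple of `u`
-- modulo `I(Z)`, and saturation applies.
lemma mem_of_mul_mem {v : Fin (n + 1) → k} (hZ : Z.ideal.radical = pointIdeal v) {s : ℕ}
    {u : MvPolynomial (Fin (n + 1)) k} (hu : u.IsHomogeneous s) (huv : eval v u ≠ 0)
    {p : MvPolynomial (Fin (n + 1)) k} (h : u * p ∈ Z.ideal) : p ∈ Z.ideal := by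
  have hrad : ∀ i, ∃ N : ℕ, (C (eval v u) * X i ^ s - C (v i ^ s) * u) ^ N ∈ Z.ideal := by
    intro i
    rw [← Ideal.mem_radical_iff, hZ]
    refine mem_pointIdeal_of_isHomogeneous (t := s)
      ((isHomogeneous_C_mul_X_pow _ _ _).sub (hu.C_mul _)) ?_
    simp only [map_sub, map_mul, map_pow, eval_C, eval_X]
    ring
  choose N hN using hrad
  refine Z.mem_of_X_pow_mul_mem (fun i => s * N i) fun i => ?_
  obtain ⟨w, hw⟩ : u ∣ (C (eval v u) * X i ^ s) ^ N i -
      (C (eval v u) * X i ^ s - C (v i ^ s) * u) ^ N i :=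
    (Dvd.intro_left (C (v i ^ s)) (by ring)).trans (sub_dvd_pow_sub_pow _ _ _)
  have h1 : (C (eval v u) * X i ^ s) ^ N i * p ∈ Z.ideal := by
    rw [sub_eq_iff_eq_add.mp hw, add_mul]
    refine add_mem ?_ (Z.ideal.mul_mem_right _ (hN i))
    rw [mul_right_comm]
    exact Z.ideal.mul_mem_right _ h
  have h2 := Z.ideal.mul_mem_left (C ((eval v u)⁻¹ ^ N i)) h1
  rwa [mul_pow, ← mul_assoc, ← mul_assoc, ← C_pow, ← C_mul, ← mul_pow, inv_mul_cancel₀ huv,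
    one_pow, C_1, one_mul, ← pow_mul] at h2

/-- The degree-`t` component of the homogeneous coordinate ring. -/
noncomputable def gradedPiece (t : ℕ) :
    Submodule k (MvPolynomial (Fin (n + 1)) k ⧸ Z.ideal) :=
  (homogeneousSubmodule (Fin (n + 1)) k t).map (Ideal.Quotient.mkₐ k Z.ideal).toLinearMap

lemma mk_mem_gradedPiece {t : ℕ} {p : MvPolynomial (Fin (n + 1)) k} (hp : p.IsHomogeneous t) :
    Ideal.Quotient.mk Z.ideal p ∈ Z.gradedPiece t :=
  ⟨p, hp, rfl⟩

instance (t : ℕ) : Module.Finite k (Z.gradedPiece t) :=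
  Module.Finite.iff_fg.mpr ((homogeneousSubmodule_fg (R := k) (σ := Fin (n + 1)) t).map _)

lemma hilbertFunction_eq (t : ℕ) : Z.hilbertFunction t = Module.finrank k (Z.gradedPiece t) := rfl

/-- Multiplication by a coordinate that is nonzero at the support is injective on the coordinate
ring. -/
lemma hilbertFunction_mono : Monotone Z.hilbertFunction := by
  refine monotone_nat_of_le_succ fun t => ?_
  obtain ⟨v, hv, hZ⟩ := Z.exists_support
  obtain ⟨j, hj⟩ := Function.ne_iff.mp hv
  rw [hilbertFunction_eq, hilbertFunction_eq]
  let f : (MvPolynomial (Fin (n + 1)) k ⧸ Z.ideal) →ₗ[k] (MvPolynomial (Fin (n + 1)) k ⧸ Z.ideal) :=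
    LinearMap.mulLeft k (Ideal.Quotient.mk Z.ideal (X j))
  have hf : Function.Injective f := by
    rw [injective_iff_map_eq_zero]
    intro a ha
    obtain ⟨p, rfl⟩ := Ideal.Quotient.mk_surjective a
    rw [LinearMap.mulLeft_apply, ← map_mul, Ideal.Quotient.eq_zero_iff_mem] at ha
    rw [Ideal.Quotient.eq_zero_iff_mem]
    exact mem_of_mul_mem hZ (isHomogeneous_X k j) (by simpa using hj) ha
  rw [(Submodule.equivMapOfInjective f hf (Z.gradedPiece t)).finrank_eq]
  refine Submodule.finrank_mono ?_
  rintro _ ⟨_, ⟨p, hp, rfl⟩, rfl⟩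
  exact Z.mk_mem_gradedPiece (t := t + 1) (p := X j * p)
    (add_comm 1 t ▸ (isHomogeneous_X k j).mul hp)

variable {Z} in
lemma HasLength.hilbertFunction_le {r : ℕ} (h : Z.HasLength r) (t : ℕ) :
    Z.hilbertFunction t ≤ r := by
  obtain ⟨s, hs⟩ := Filter.eventually_atTop.mp h
  exact (Z.hilbertFunction_mono (le_max_left t s)).trans_eq (hs _ (le_max_right t s))

lemma hasLength_of_hilbertFunction_le {r : ℕ} (h : ∀ t, Z.hilbertFunction t ≤ r) :
    ∃ s ≤ r, Z.HasLength s := by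
  obtain ⟨m, hm⟩ := Nat.sSup_mem (s := Set.range Z.hilbertFunction) (Set.range_nonempty _)
    ⟨r, by rintro _ ⟨t, rfl⟩; exact h t⟩
  refine ⟨Z.hilbertFunction m, h m, Filter.eventually_atTop.mpr ⟨m, fun t ht => ?_⟩⟩
  refine le_antisymm ?_ (Z.hilbertFunction_mono ht)
  rw [hm]
  exact le_csSup ⟨r, by rintro _ ⟨t, rfl⟩; exact h t⟩ ⟨t, rfl⟩

variable {Z} in
lemma map_gradedPiece_of_le {Y : LocalScheme k n} (h : Z.ideal ≤ Y.ideal) (t : ℕ) :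
    (Z.gradedPiece t).map (Ideal.Quotient.factorₐ k h).toLinearMap = Y.gradedPiece t := by
  unfold gradedPiece
  rw [← Submodule.map_comp]
  rfl

variable {Z} in
lemma hilbertFunction_le_of_le {Y : LocalScheme k n} (h : Z.ideal ≤ Y.ideal) (t : ℕ) :
    Y.hilbertFunction t ≤ Z.hilbertFunction t := by
  rw [hilbertFunction_eq, hilbertFunction_eq, ← map_gradedPiece_of_le h]
  exact Submodule.finrank_map_le _ _

variable {Z} in
/-- A local scheme has no proper closed local subscheme of the same length. -/
lemma eq_of_le_of_hasLength {Y : LocalScheme k n} (h : Z.ideal ≤ Y.ideal) {r : ℕ}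
    (hZr : Z.HasLength r) (hYr : Y.HasLength r) : Z = Y := by
  refine LocalScheme.ext (le_antisymm h fun p hp => mem_of_homogeneousComponent_mem fun s => ?_)
  obtain ⟨v, hv, hZ⟩ := Z.exists_support
  obtain ⟨j, hj⟩ := Function.ne_iff.mp hv
  obtain ⟨m, hm⟩ := Filter.eventually_atTop.mp (hZr.and hYr)
  obtain ⟨hm1, hm2⟩ := hm (m + s) (Nat.le_add_right m s)
  rw [hilbertFunction_eq] at hm1 hm2
  let f : Z.gradedPiece (m + s) →ₗ[k] Y.gradedPiece (m + s) :=
    (Ideal.Quotient.factorₐ k h).toLinearMap.restrict fun x hx =>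
      map_gradedPiece_of_le h (m + s) ▸ Submodule.mem_map_of_mem hx
  have hsurj : Function.Surjective f := by
    rintro ⟨y, hy⟩
    rw [← map_gradedPiece_of_le h] at hy
    obtain ⟨x, hx, rfl⟩ := hy
    exact ⟨⟨x, hx⟩, rfl⟩
  have hinj : Function.Injective f :=
    (LinearMap.injective_iff_surjective_of_finrank_eq_finrank (hm1.trans hm2.symm)).mpr hsurj
  -- The factor `X j ^ m` moves the component into a degree where both Hilbert functions equal `r`;
  -- it is cancelled at the end.
  have hXp : X j ^ m * homogeneousComponent s p ∈ Y.ideal :=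
    Y.ideal.mul_mem_left _ (Y.isHomogeneous p hp s)
  have hhom : (X j ^ m * homogeneousComponent s p).IsHomogeneous (m + s) :=
    (isHomogeneous_X_pow j m).mul (homogeneousComponent_isHomogeneous s p)
  have h0 : (⟨_, Z.mk_mem_gradedPiece hhom⟩ : Z.gradedPiece (m + s)) = 0 := by
    apply hinj
    rw [map_zero]
    exact Subtype.ext (Ideal.Quotient.eq_zero_iff_mem.mpr hXp)
  refine mem_of_mul_mem hZ (isHomogeneous_X_pow j m) (by simpa using pow_ne_zero m hj) ?_
  exact Ideal.Quotient.eq_zero_iff_mem.mp (congrArg Subtype.val h0)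

end LocalScheme

/-! ### Linear forms vanishing at a point, and the dual linear form. -/

section LinearForms

variable {k : Type*} [Field k] {n : ℕ}

/-- Matrix of the substitution `y_i ↦ y_i - (v_i / v_j) y_j`, which projects onto the linear forms
that vanish at `v` along `y_j`. -/
noncomputable def projMatrix (v : Fin (n + 1) → k) (j i m : Fin (n + 1)) : k :=
  (if i = m then 1 else 0) - (if j = m then v i / v j else 0)

/-- The linear form `y_i - (v_i / v_j) y_j`, which vanishes at `v`. -/
noncomputable def projForm (v : Fin (n + 1) → k) (j i : Fin (n + 1)) :
    MvPolynomial (Fin (n + 1)) k :=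
  ∑ m, projMatrix v j i m • X m

/-- The linear form `∑ v_i x_i` dual to `v`. -/
noncomputable def dualForm (v : Fin (n + 1) → k) : MvPolynomial (Fin (n + 1)) k :=
  ∑ i, v i • X i

lemma projForm_eq (v : Fin (n + 1) → k) (j i : Fin (n + 1)) :
    projForm v j i = X i - C (v i / v j) * X j := by
  simp [projForm, projMatrix, sub_smul, ite_smul, Finset.sum_sub_distrib, smul_eq_C_mul]

lemma projForm_isHomogeneous (v : Fin (n + 1) → k) (j i : Fin (n + 1)) :
    (projForm v j i).IsHomogeneous 1 := by
  rw [projForm_eq]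
  exact (isHomogeneous_X k i).sub (isHomogeneous_C_mul_X _ _)

lemma eval_projForm {v : Fin (n + 1) → k} {j : Fin (n + 1)} (hj : v j ≠ 0) (i : Fin (n + 1)) :
    eval v (projForm v j i) = 0 := by
  rw [projForm_eq]
  simp [div_mul_cancel₀ _ hj]

lemma X_dvd_sub_aeval_projForm (v : Fin (n + 1) → k) (j : Fin (n + 1))
    (p : MvPolynomial (Fin (n + 1)) k) : X j ∣ p - aeval (projForm v j) p := by
  rw [← Ideal.mem_span_singleton]
  refine sub_aeval_mem (fun i => ?_) p
  rw [projForm_eq, sub_sub_cancel]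
  exact Ideal.mul_mem_left _ _ (Ideal.mem_span_singleton_self _)

lemma sum_projMatrix_smul_X {v : Fin (n + 1) → k} {j : Fin (n + 1)} (m : Fin (n + 1)) :
    ∑ i, projMatrix v j i m • (X i : MvPolynomial (Fin (n + 1)) k) =
      X m - (if j = m then C (v j)⁻¹ else 0) * dualForm v := by
  simp only [projMatrix, sub_smul, ite_smul, Finset.sum_sub_distrib, one_smul, zero_smul,
    Finset.sum_ite_eq', Finset.mem_univ, if_true]
  congr 1
  split_ifs with h
  · rw [dualForm, Finset.mul_sum]
    refine Finset.sum_congr rfl fun i _ => ?_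
    rw [← smul_eq_C_mul, smul_smul, div_eq_inv_mul]
  · simp

lemma dualForm_isHomogeneous (v : Fin (n + 1) → k) : (dualForm v).IsHomogeneous 1 := by
  refine IsHomogeneous.sum _ _ _ fun i _ => ?_
  rw [smul_eq_C_mul]
  exact isHomogeneous_C_mul_X _ _

lemma coeff_single_dualForm (v : Fin (n + 1) → k) (i : Fin (n + 1)) :
    coeff (Finsupp.single i 1) (dualForm v) = v i := by
  classical
  simp [dualForm, coeff_sum, coeff_X, Finsupp.single_left_inj]

lemma dualForm_ne_zero {v : Fin (n + 1) → k} (hv : v ≠ 0) : dualForm v ≠ 0 := by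
  intro h
  refine hv (funext fun i => ?_)
  rw [← coeff_single_dualForm v i, h, coeff_zero, Pi.zero_apply]

lemma irreducible_dualForm {v : Fin (n + 1) → k} (hv : v ≠ 0) : Irreducible (dualForm v) := by
  refine irreducible_of_totalDegree_eq_one
    ((dualForm_isHomogeneous v).totalDegree (dualForm_ne_zero hv)) fun x hx => ?_
  obtain ⟨j, hj⟩ := Function.ne_iff.mp hv
  have := hx (Finsupp.single j 1)
  rw [coeff_single_dualForm] at this
  exact isUnit_of_dvd_unit this (isUnit_iff_ne_zero.mpr hj)

/-- Both forms have degree one, so the quotient is a constant. -/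
lemma exists_smul_eq_of_dualForm_dvd {v w : Fin (n + 1) → k} (hw : w ≠ 0)
    (h : dualForm v ∣ dualForm w) : ∃ c : k, c ≠ 0 ∧ w = c • v := by
  obtain ⟨q, hq⟩ := h
  have hw0 := dualForm_ne_zero hw
  have hv0 : dualForm v ≠ 0 := by rintro h; simp [h] at hq; exact hw0 hq
  have hq0 : q ≠ 0 := by rintro rfl; simp at hq; exact hw0 hq
  have hdeg := congrArg totalDegree hq
  rw [totalDegree_mul_of_isDomain hv0 hq0, (dualForm_isHomogeneous v).totalDegree hv0,
    (dualForm_isHomogeneous w).totalDegree hw0] at hdeg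
  obtain ⟨c, rfl⟩ : ∃ c, q = C c := ⟨_, totalDegree_eq_zero_iff_eq_C.mp (by omega)⟩
  refine ⟨c, by rintro rfl; simp at hq0, funext fun i => ?_⟩
  rw [← coeff_single_dualForm w, hq, mul_comm, coeff_C_mul, coeff_single_dualForm, Pi.smul_apply,
    smul_eq_mul]

lemma list_prod_isHomogeneous (l : List (MvPolynomial (Fin (n + 1)) k))
    (h : ∀ w ∈ l, w.IsHomogeneous 1) : l.prod.IsHomogeneous l.length := by
  induction l with
  | nil => exact isHomogeneous_one _ _
  | cons w l ih =>
    rw [List.prod_cons, List.length_cons, add_comm l.length]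
    exact (h w List.mem_cons_self).mul (ih fun x hx => h x (List.mem_cons_of_mem _ hx))

end LinearForms

/-! ### Powers of the ideal of the support, and divisibility of `F`. -/

namespace LocalScheme

variable {k : Type*} [Field k] {n : ℕ} {Z : LocalScheme k n}

/-- On a local scheme of length `r`, any product of at least `r` linear forms that vanish at the
support is zero. -/
lemma list_prod_mem {v : Fin (n + 1) → k} {j : Fin (n + 1)} (hj : v j ≠ 0)
    (hZ : Z.ideal.radical = pointIdeal v) {r : ℕ} (hr : Z.HasLength r)
    (l : List (MvPolynomial (Fin (n + 1)) k)) (hl : ∀ w ∈ l, w.IsHomogeneous 1 ∧ eval v w = 0)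
    (hlr : r ≤ l.length) : l.prod ∈ Z.ideal := by
  set L := l.length with hL
  -- `P i m` is the product of the factors of `l` from position `i` up to `m`, padded by `X j`. The
  -- `L + 1` forms `P 0 m` have degree `L`, where the Hilbert function is at most `r ≤ L`, so they
  -- are dependent modulo `I(Z)`.
  let P : ℕ → ℕ → MvPolynomial (Fin (n + 1)) k := fun i m =>
    X j ^ (L - m) * ((l.drop i).take (m - i)).prod
  have hPhom : ∀ i m, i ≤ m → m ≤ L → (P i m).IsHomogeneous (L - i) := by
    intro i m him hm
    have h1 := list_prod_isHomogeneous ((l.drop i).take (m - i))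
      fun w hw => (hl w (List.mem_of_mem_drop (List.mem_of_mem_take hw))).1
    have h2 := (isHomogeneous_X_pow (R := k) j (L - m)).mul h1
    convert h2 using 1
    rw [List.length_take, List.length_drop]
    omega
  let u : Fin (L + 1) → Z.gradedPiece L := fun i =>
    ⟨_, Z.mk_mem_gradedPiece (hPhom 0 i (Nat.zero_le _) (Nat.lt_succ_iff.mp i.2))⟩
  have hdep : ¬ LinearIndependent k u := by
    intro h
    have h1 := h.fintype_card_le_finrank
    have h2 := hr.hilbertFunction_le L
    rw [hilbertFunction_eq] at h2
    rw [Fintype.card_fin] at h1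
    omega
  obtain ⟨g, hg, i₀, hi₀⟩ := Fintype.not_linearIndependent_iff.mp hdep
  have hmem : ∑ m, g m • P 0 m ∈ Z.ideal := by
    rw [← Ideal.Quotient.eq_zero_iff_mem, ← Ideal.Quotient.mkₐ_eq_mk k, map_sum]
    have := congrArg Subtype.val hg
    rw [Submodule.coe_sum, Submodule.coe_zero] at this
    rw [← this]
    exact Finset.sum_congr rfl fun m _ => by rw [map_smul]; rfl
  -- With `i` the first index in the relation, the first `i` factors of `l` split off; the cofactor
  -- `w` will be nonzero at `v`, hence cancellable.
  obtain ⟨i, hi, hmin⟩ := wellFounded_lt.has_min {i | g i ≠ 0} ⟨i₀, hi₀⟩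
  have hiL : (i : ℕ) ≤ L := Nat.lt_succ_iff.mp i.2
  have hzero : ∀ m, m < i → g m = 0 := fun m hm => by
    by_contra h
    exact hmin m h hm
  let w := ∑ m, g m • P i m
  have hfactor : ∑ m, g m • P 0 m = w * (l.take i).prod := by
    rw [Finset.sum_mul]
    refine Finset.sum_congr rfl fun m _ => ?_
    rcases lt_or_ge m i with hm | hm
    · rw [hzero m hm, zero_smul, zero_smul, zero_mul]
    · simp only [P]
      rw [smul_mul_assoc, mul_assoc, mul_comm _ (l.take i).prod, ← List.prod_append,
        ← List.take_add, Nat.add_sub_cancel' hm, Nat.sub_zero, List.drop_zero]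
  have hw : w.IsHomogeneous (L - i) := by
    refine IsHomogeneous.sum _ _ _ fun m _ => ?_
    rcases lt_or_ge m i with hm | hm
    · rw [hzero m hm, zero_smul]; exact isHomogeneous_zero ..
    · rw [smul_eq_C_mul]
      exact (hPhom i m hm (Nat.lt_succ_iff.mp m.2)).C_mul _
  -- At `v` only the term `m = i` survives, since later terms contain a factor from `l`.
  have hwv : eval v w ≠ 0 := by
    rw [map_sum, Finset.sum_eq_single i]
    · simp only [P]
      rw [smul_eval, Nat.sub_self, List.take_zero, List.prod_nil, mul_one, map_pow, eval_X]
      exact mul_ne_zero hi (pow_ne_zero _ hj)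
    · intro m _ hmi
      rcases lt_or_gt_of_ne hmi with hm | hm
      · rw [hzero m hm, zero_smul, map_zero]
      · have hm' : (i : ℕ) < m := hm
        have hmL : (m : ℕ) ≤ L := Nat.lt_succ_iff.mp m.2
        have h0 : eval v ((l.drop i).take (m - i)).prod = 0 := by
          rw [map_list_prod]
          refine List.prod_eq_zero ?_
          have hne : (l.drop i).take (m - i) ≠ [] := by
            intro h
            have := congrArg List.length h
            rw [List.length_take, List.length_drop, List.length_nil] at this
            omega
          obtain ⟨x, hx⟩ := List.exists_mem_of_ne_nil _ hne
          exact List.mem_map.mpr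
            ⟨x, hx, (hl x (List.mem_of_mem_drop (List.mem_of_mem_take hx))).2⟩
        rw [smul_eval, map_mul, h0, mul_zero, mul_zero]
    · exact fun h => absurd (Finset.mem_univ i) h
  have htake : (l.take i).prod ∈ Z.ideal := mem_of_mul_mem hZ hw hwv (hfactor ▸ hmem)
  rw [← List.prod_take_mul_prod_drop l i]
  exact Z.ideal.mul_mem_right _ htake

/-- Each monomial of degree `t` becomes a product of `t ≥ r` linear forms vanishing at `v`. -/
lemma aeval_projForm_mem {v : Fin (n + 1) → k} {j : Fin (n + 1)} (hj : v j ≠ 0)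
    (hZ : Z.ideal.radical = pointIdeal v) {r t : ℕ} (hr : Z.HasLength r) (hrt : r ≤ t)
    {p : MvPolynomial (Fin (n + 1)) k} (hp : p.IsHomogeneous t) :
    aeval (projForm v j) p ∈ Z.ideal := by
  rw [aeval_def, eval₂_eq']
  refine sum_mem fun β hβ => Z.ideal.mul_mem_left _ ?_
  let s : Multiset (MvPolynomial (Fin (n + 1)) k) :=
    ∑ i, Multiset.replicate (β i) (projForm v j i)
  have hs : s.toList.prod = ∏ i, projForm v j i ^ β i := by
    rw [Multiset.prod_toList, Multiset.prod_sum]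
    exact Finset.prod_congr rfl fun i _ => Multiset.prod_replicate _ _
  rw [← hs]
  refine list_prod_mem hj hZ hr _ (fun w hw => ?_) ?_
  · rw [Multiset.mem_toList, Multiset.mem_sum] at hw
    obtain ⟨i, -, hw⟩ := hw
    rw [Multiset.eq_of_mem_replicate hw]
    exact ⟨projForm_isHomogeneous v j i, eval_projForm hj i⟩
  · rw [Multiset.length_toList, Multiset.card_sum]
    simp only [Multiset.card_replicate]
    rw [← Finsupp.degree_eq_sum]
    have := hp.degree_eq_sum_deg_support hβ
    rw [← Finsupp.degree_apply] at this
    omega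

/-- A form with an apolar local scheme of length at most its degree is divisible by the linear form
dual to the support. -/
lemma dualForm_dvd {v : Fin (n + 1) → k} (hv : v ≠ 0)
    (hZ : Z.ideal.radical = pointIdeal v) {r d : ℕ} (hr : Z.HasLength r) (hrd : r ≤ d)
    (hchar : ringChar k = 0 ∨ d < ringChar k) {F : MvPolynomial (Fin (n + 1)) k}
    (hF : F.IsHomogeneous d) (hZF : Z.IsApolarTo F) : dualForm v ∣ F := by
  obtain ⟨j, hj⟩ := Function.ne_iff.mp hv
  -- The transpose of the projection `projForm`. Each `z m` differs from `X m` by a multiple of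
  -- `dualForm v`, so it suffices that `F` becomes zero under `z`.
  let z : Fin (n + 1) → MvPolynomial (Fin (n + 1)) k :=
    fun m => ∑ i, projMatrix v j i m • (X i : MvPolynomial (Fin (n + 1)) k)
  have hz : ∀ m, (z m).IsHomogeneous 1 := fun m => IsHomogeneous.sum _ _ _ fun i _ => by
    rw [smul_eq_C_mul]
    exact isHomogeneous_C_mul_X _ _
  have hzero : aeval z F = 0 := by
    rw [← diffAction_one (aeval z F)]
    have hhom : (aeval z F).IsHomogeneous d := by
      simpa using hF.aeval z hz
    -- A form of degree `d` is zero once every operator of degree `d` kills it; adjointness moves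
    -- the operator `q` to `q(projForm)`, which lies in `I(Z)`.
    refine diffAction_eq_zero_of_mul hchar hhom d 0 1 (isHomogeneous_one _ _) (zero_add d)
      fun q hq => ?_
    rw [mul_one, diffAction_aeval_transpose]
    have := hZF _ (aeval_projForm_mem hj hZ hr hrd hq)
    unfold projForm at this
    rw [this, map_zero]
  have hmem : F - aeval z F ∈ Ideal.span {dualForm v} := by
    refine sub_aeval_mem (fun m => ?_) F
    simp only [z]
    rw [sum_projMatrix_smul_X, sub_sub_cancel]
    exact Ideal.mul_mem_left _ _ (Ideal.mem_span_singleton_self _)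
  rwa [hzero, sub_zero, Ideal.mem_span_singleton] at hmem

/-! ### Intersection of two local schemes with the same support. -/

/-- The sum of the ideals of two local schemes of length at most `t` with the same support is
saturated in degree `t`. -/
lemma mem_sup_of_X_mul_mem {Y : LocalScheme k n} {v : Fin (n + 1) → k} {j : Fin (n + 1)} (hj : v j ≠ 0)
    (hZ : Z.ideal.radical = pointIdeal v) (hY : Y.ideal.radical = pointIdeal v)
    {r t : ℕ} (hZr : Z.HasLength r) (hYr : Y.HasLength r) (hrt : r ≤ t)
    {p : MvPolynomial (Fin (n + 1)) k} (hp : p.IsHomogeneous t)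
    (h : X j * p ∈ Z.ideal ⊔ Y.ideal) : p ∈ Z.ideal ⊔ Y.ideal := by
  obtain ⟨a, ha, b, hb, hab⟩ := Submodule.mem_sup.mp h
  -- Split off the part of `c` not divisible by `X j`: it is a form of degree at least `r` in the
  -- `projForm`s, so it lies in the ideal, and the quotient `c'` does too.
  have key : ∀ W : LocalScheme k n, W.ideal.radical = pointIdeal v → W.HasLength r →
      ∀ c ∈ W.ideal, ∃ c' ∈ W.ideal, homogeneousComponent (1 + t) c =
        aeval (projForm v j) (homogeneousComponent (1 + t) c) + X j * c' := by
    intro W hW hWr c hc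
    obtain ⟨c', hc'⟩ := X_dvd_sub_aeval_projForm v j (homogeneousComponent (1 + t) c)
    refine ⟨c', ?_, sub_eq_iff_eq_add'.mp hc'⟩
    refine mem_of_mul_mem hW (isHomogeneous_X k j) (by rwa [eval_X]) ?_
    rw [← hc']
    exact sub_mem (W.isHomogeneous c hc _) (aeval_projForm_mem hj hW hWr (by omega)
      (homogeneousComponent_isHomogeneous _ _))
  obtain ⟨a', ha', haa⟩ := key Z hZ hZr a ha
  obtain ⟨b', hb', hbb⟩ := key Y hY hYr b hb
  have hsum : homogeneousComponent (1 + t) a + homogeneousComponent (1 + t) b = X j * p := by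
    rw [← map_add, hab]
    exact homogeneousComponent_eq_self ((isHomogeneous_X k j).mul hp)
  -- Both remainders lie in `I(Z)`, even the one coming from `Y`: that membership depends only on
  -- support, length and degree.
  have hmem : p - a' - b' ∈ Z.ideal := by
    refine mem_of_mul_mem hZ (isHomogeneous_X k j) (by rwa [eval_X]) ?_
    have : X j * (p - a' - b') = aeval (projForm v j) (homogeneousComponent (1 + t) a) +
        aeval (projForm v j) (homogeneousComponent (1 + t) b) := by
      linear_combination -hsum + haa + hbb
    rw [this]
    exact add_mem
      (aeval_projForm_mem hj hZ hZr (by omega) (homogeneousComponent_isHomogeneous _ _))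
      (aeval_projForm_mem hj hZ hZr (by omega) (homogeneousComponent_isHomogeneous _ _))
  have := Submodule.add_mem_sup (add_mem hmem ha') hb'
  rwa [sub_right_comm, sub_add_cancel, sub_add_cancel] at this

/-- The saturation of the intersection of two local schemes with the same support. -/
noncomputable def inter (Z Y : LocalScheme k n) {v : Fin (n + 1) → k} {j : Fin (n + 1)}
    (hj : v j ≠ 0) (hZ : Z.ideal.radical = pointIdeal v)
    (hY : Y.ideal.radical = pointIdeal v) : LocalScheme k n where
  ideal :=
    -- Saturating by `X j` alone suffices, as `X j` does not vanish at the common support.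
    { carrier := {p | ∃ N : ℕ, X j ^ N * p ∈ Z.ideal ⊔ Y.ideal}
      add_mem' := by
        rintro p q ⟨N, hN⟩ ⟨M, hM⟩
        refine ⟨N + M, ?_⟩
        rw [mul_add]
        refine add_mem ?_ ?_
        · rw [add_comm N, pow_add, mul_assoc]
          exact Ideal.mul_mem_left _ _ hN
        · rw [pow_add, mul_assoc]
          exact Ideal.mul_mem_left _ _ hM
      zero_mem' := ⟨0, by simp⟩
      smul_mem' := by
        rintro c p ⟨N, hN⟩
        refine ⟨N, ?_⟩
        rw [smul_eq_mul, mul_left_comm]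
        exact Ideal.mul_mem_left _ _ hN }
  isHomogeneous := by
    rintro p ⟨N, hN⟩ t
    refine ⟨N, ?_⟩
    rw [← homogeneousComponent_add_mul (isHomogeneous_X_pow j N)]
    exact homogeneousComponent_mem_sup Z.isHomogeneous Y.isHomogeneous _ hN _
  isSaturated := by
    intro p hp
    obtain ⟨N, hN⟩ := hp j
    exact ⟨N + 1, by rwa [pow_succ, mul_assoc]⟩
  exists_support := by
    refine ⟨v, fun h => hj (by rw [h, Pi.zero_apply]), le_antisymm ?_ ?_⟩
    · have hrad : (pointIdeal v).IsRadical := hZ ▸ Ideal.radical_isRadical _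
      refine (hrad.radical_le_iff).mpr ?_
      rintro p ⟨N, hN⟩
      refine mem_of_homogeneousComponent_mem fun t => ?_
      refine mem_pointIdeal_of_isHomogeneous (homogeneousComponent_isHomogeneous t p) ?_
      have h1 := homogeneousComponent_mem_sup Z.isHomogeneous Y.isHomogeneous _ hN (N + t)
      rw [homogeneousComponent_add_mul (isHomogeneous_X_pow j N)] at h1
      have h2 : Z.ideal ⊔ Y.ideal ≤ pointIdeal v :=
        sup_le (hZ ▸ Ideal.le_radical) (hY ▸ Ideal.le_radical)
      have h3 := eval_eq_zero_of_mem_pointIdeal (h2 h1)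
      rw [map_mul, map_pow, eval_X] at h3
      exact (mul_eq_zero.mp h3).resolve_left (pow_ne_zero _ hj)
    · rw [← hZ]
      refine Ideal.radical_mono fun p hp => ⟨0, ?_⟩
      rw [pow_zero, one_mul]
      exact Ideal.mem_sup_left hp

section Inter

variable {Y : LocalScheme k n} {v : Fin (n + 1) → k} {j : Fin (n + 1)} (hj : v j ≠ 0)
  (hZ : Z.ideal.radical = pointIdeal v) (hY : Y.ideal.radical = pointIdeal v)

lemma left_le_inter : Z.ideal ≤ (Z.inter Y hj hZ hY).ideal := fun p hp =>
  ⟨0, by rw [pow_zero, one_mul]; exact Ideal.mem_sup_left hp⟩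

lemma right_le_inter : Y.ideal ≤ (Z.inter Y hj hZ hY).ideal := fun p hp =>
  ⟨0, by rw [pow_zero, one_mul]; exact Ideal.mem_sup_right hp⟩

/-- In degrees at least `d ≥ r` the saturation adds nothing to `I(Z) + I(Y)`, which kills `F`. An
element of lower degree is tested on its multiples of degree `d`. -/
lemma inter_isApolarTo {r d : ℕ} (hZr : Z.HasLength r) (hYr : Y.HasLength r) (hrd : r ≤ d)
    (hchar : ringChar k = 0 ∨ d < ringChar k) {F : MvPolynomial (Fin (n + 1)) k}
    (hF : F.IsHomogeneous d) (hZF : Z.IsApolarTo F) (hYF : Y.IsApolarTo F) :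
    (Z.inter Y hj hZ hY).IsApolarTo F := by
  have hlarge : ∀ t, d ≤ t → ∀ q ∈ (Z.inter Y hj hZ hY).ideal, q.IsHomogeneous t →
      diffAction q F = 0 := by
    rintro t ht q ⟨N, hN⟩ hq
    have hmem : q ∈ Z.ideal ⊔ Y.ideal := by
      induction N with
      | zero => simpa using hN
      | succ N ih =>
        refine ih (mem_sup_of_X_mul_mem hj hZ hY hZr hYr (t := N + t) (by omega)
          ((isHomogeneous_X_pow j N).mul hq) ?_)
        rwa [← mul_assoc, ← pow_succ']
    obtain ⟨a, ha, b, hb, rfl⟩ := Submodule.mem_sup.mp hmem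
    rw [diffAction_add, hZF a ha, hYF b hb, add_zero]
  intro p hp
  rw [← diffActionLinear_apply, ← sum_homogeneousComponent p, map_sum]
  refine Finset.sum_eq_zero fun t _ => ?_
  have hpt := (Z.inter Y hj hZ hY).isHomogeneous p hp t
  have hhom := homogeneousComponent_isHomogeneous t p
  rw [diffActionLinear_apply]
  rcases le_total d t with ht | ht
  · exact hlarge t ht _ hpt hhom
  · refine diffAction_eq_zero_of_mul hchar hF (d - t) t _ hhom (by omega) fun q hq => ?_
    exact hlarge (d - t + t) (by omega) _ (Ideal.mul_mem_left _ _ hpt) (hq.mul hhom)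

end Inter

/-- Minimal local apolar schemes of length at most the degree are determined by their support. -/
lemma IsMinimalApolarTo.eq_of_radical_eq {Y : LocalScheme k n} {d : ℕ}
    (hchar : ringChar k = 0 ∨ d < ringChar k) {F : MvPolynomial (Fin (n + 1)) k}
    (hF : F.IsHomogeneous d) (hrank : localCactusRank F ≤ d) (hZF : Z.IsMinimalApolarTo F)
    (hYF : Y.IsMinimalApolarTo F) (h : Z.ideal.radical = Y.ideal.radical) : Z = Y := by
  obtain ⟨v, hv, hZ⟩ := Z.exists_support
  obtain ⟨j, hj⟩ := Function.ne_iff.mp hv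
  have hY : Y.ideal.radical = pointIdeal v := h ▸ hZ
  have hap := inter_isApolarTo hj hZ hY hZF.2 hYF.2 hrank hchar hF hZF.1 hYF.1
  obtain ⟨s, hs, hlen⟩ := (Z.inter Y hj hZ hY).hasLength_of_hilbertFunction_le fun t =>
    (hilbertFunction_le_of_le (left_le_inter hj hZ hY) t).trans (hZF.2.hilbertFunction_le t)
  have hmin : localCactusRank F ≤ s := Nat.sInf_le ⟨_, hap, hlen⟩
  obtain rfl : s = localCactusRank F := le_antisymm hs hmin
  -- The intersection has the same length as `Z` and `Y`, so it coincides with each.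
  exact (eq_of_le_of_hasLength (left_le_inter hj hZ hY) hZF.2 hlen).trans
    (eq_of_le_of_hasLength (right_le_inter hj hZ hY) hYF.2 hlen).symm

end LocalScheme

/-! ### Counting supports. -/

theorem corollary3 {k : Type*} [Field k] (n d : ℕ) (hn : 0 < n)
    (hchar : ringChar k = 0 ∨ d < ringChar k)
    (F : MvPolynomial (Fin (n + 1)) k) (hF : F.IsHomogeneous d) (hF0 : F ≠ 0)
    (hrank : localCactusRank F ≤ d) :
    {Z : LocalScheme k n | Z.IsMinimalApolarTo F}.encard ≤ ((d ^ n : ℕ) : ℕ∞) := by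
  classical
  by_contra! hlt
  have hcard : ((d + 1 : ℕ) : ℕ∞) ≤ {Z : LocalScheme k n | Z.IsMinimalApolarTo F}.encard := by
    refine le_trans ?_ (Order.add_one_le_of_lt hlt)
    -- Since `n ≥ 1`, `d ≤ d ^ n`; so `d + 1` minimal schemes can be chosen, and their dual forms
    -- would give `F` a divisor of degree `d + 1`.
    exact_mod_cast Nat.succ_le_succ (Nat.le_self_pow hn.ne' d)
  obtain ⟨T, hT, hTcard⟩ := Set.exists_subset_encard_eq hcard
  have hfin : T.Finite := Set.finite_of_encard_eq_coe hTcard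
  choose v hv hvZ using fun Z : LocalScheme k n => Z.exists_support
  have hdvd : ∏ Z ∈ hfin.toFinset, dualForm (v Z) ∣ F := by
    refine Finset.prod_dvd_of_isRelPrime ?_ fun Z hZ => ?_
    · intro Z hZ Y hY hne
      have hZT := hT (hfin.mem_toFinset.mp hZ)
      have hYT := hT (hfin.mem_toFinset.mp hY)
      -- Associated dual forms would mean the same support, hence the same scheme.
      refine (irreducible_dualForm (hv Z)).isRelPrime_iff_not_dvd.mpr fun h => hne ?_
      obtain ⟨c, hc, hcv⟩ := exists_smul_eq_of_dualForm_dvd (hv Y) h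
      refine LocalScheme.IsMinimalApolarTo.eq_of_radical_eq hchar hF hrank hZT hYT ?_
      rw [hvZ, hvZ, hcv, pointIdeal_smul hc]
    · have hZT := hT (hfin.mem_toFinset.mp hZ)
      exact LocalScheme.dualForm_dvd (hv Z) (hvZ Z) hZT.2 hrank hchar hF hZT.1
  have hprod : (∏ Z ∈ hfin.toFinset, dualForm (v Z)).totalDegree = hfin.toFinset.card := by
    have h := IsHomogeneous.prod hfin.toFinset (fun Z => dualForm (v Z)) (fun _ => 1)
      fun Z _ => dualForm_isHomogeneous (v Z)
    rw [h.totalDegree (Finset.prod_ne_zero_iff.mpr fun Z _ => dualForm_ne_zero (hv Z)),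
      Finset.sum_const, smul_eq_mul, mul_one]
  have hdeg := (totalDegree_le_of_dvd_of_isDomain hdvd hF0).trans hF.totalDegree_le
  rw [hfin.encard_eq_coe_toFinset_card] at hTcard
  have : hfin.toFinset.card = d + 1 := by exact_mod_cast hTcard
  omega
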